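/- Let $(R,\mathfrak m)$ be a (commutative Noetherian) local ring with $\dim R=1$, and let $M$ be a nonzero finitely generated $R$-module which has rank $r$, i.e. for every associated prime $\mathfrak p$ of $R$ the $R_{\mathfrak p}$-module $M_{\mathfrak p}$ is free of rank $r$. Write $M^*=\operatorname{Hom}_R(M,R)$, let $\nu_R(-)$ denote the minimal number of generators, let $e(R)=\lim_{n\to\infty}\operatorname{length}_R(R/\mathfrak m^n)/n$ be the multiplicity of $R$, and let $\operatorname{tr}_R(M)$ be the trace of $M$, i.e. the image of the map $M^*\otimes_R M\to R$, $f\otimes x\mapsto f(x)$. Assume that $M\otimes_R M^*$ is torsionfree, i.e. no regular element of $R$ kills a nonzero element of it, and put $\rho=r/\nu_R(M)$. Then every ideal $J$ of $R$ with $J\supseteq\operatorname{tr}_R(M)$ satisfies $$\nu_R(J)\;\le\; e(R)(1-\rho)+\frac{\nu_R(M\otimes_R M^*)}{\nu_R(M)^2}\;\le\; e(R)(1-\rho+\rho^2).$$ In particular, if $r>0$ and $M$ is not free, then $\nu_R(J)\le e(R)-1$. -/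

import Mathlib

open scoped TensorProduct

/-- The minimal number of generators `ν_R(M)` of a (finitely generated) module `M`. -/
noncomputable def numGenerators (R M : Type*) [CommRing R] [AddCommGroup M] [Module R M] : ℕ :=
  (⊤ : Submodule R M).spanFinrank

/-- `M` has rank `r`: for every associated prime `p` of `R`, the localization `M_p` is a free
`R_p`-module of rank `r`. -/
def ModuleHasRank (R M : Type*) [CommRing R] [AddCommGroup M] [Module R M] (r : ℕ) : Prop :=
  ∀ (p : Ideal R) [p.IsPrime], p ∈ associatedPrimes R R →
    Module.Free (Localization.AtPrime p) (LocalizedModule p.primeCompl M) ∧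
      Module.finrank (Localization.AtPrime p) (LocalizedModule p.primeCompl M) = r

/-- The trace of `M`: the image of the evaluation map `M* ⊗ M → R`, `f ⊗ x ↦ f x`. -/
noncomputable def moduleTrace (R M : Type*) [CommRing R] [AddCommGroup M] [Module R M] :
    Ideal R :=
  LinearMap.range (contractLeft R M)

/-- The Krull dimension of a local ring as a natural number (it is finite for a Noetherian local
ring). -/
noncomputable def localDim (R : Type*) [CommRing R] : ℕ :=
  ((ringKrullDim R).unbotD 0).toNat

/-- The (Hilbert–Samuel) multiplicity `e(R) = lim_{n → ∞} d! · length(R / 𝔪ⁿ) / n ^ d` of a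
Noetherian local ring `(R, 𝔪)` of dimension `d`; the limit always exists. -/
noncomputable def localMultiplicity (R : Type*) [CommRing R] [IsLocalRing R] : ℝ :=
  Filter.limUnder Filter.atTop fun n : ℕ =>
    ((localDim R).factorial : ℝ) *
      ((Module.length R (R ⧸ IsLocalRing.maximalIdeal R ^ n)).toNat : ℝ) / (n : ℝ) ^ localDim R

/-!
Over the flat extension `R(X)`, which has infinite residue field, the numbers `ν(𝔪ᵏ)` are bounded,
so the argument of Eakin and Sathaye, applied to points of a moment curve through generators of
`𝔪`, gives `y` with `y𝔪ᵏ = 𝔪ᵏ⁺¹` for all large `k`. Then `ν(𝔪ᵏ) = e(R)` for large `k`; if `𝔪`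
contains a regular element, then `y` is regular and `e(R)` is the length of `R / yR`. Comparing
lengths of cokernels of `y` shows that an embedding `N × Rʳ ↪ Rᵐ` forces `ν(N) + r e(R) ≤ m e(R)`.

Let `K` be the kernel of a surjection `Rⁿ → M` with `n = ν(M)`. As `tr(M) ⊆ J`, we have
`Hom(M, J) = M*`, so the image of `Hom(Rⁿ, J) = Jⁿ` in `Hom(K, J) ⊆ K*` needs at least
`n ν(J) - ν(M*)` generators. Since `K* × Rʳ` embeds in `Rⁿ`, this gives the first bound. The second
comes from the embedding `M ⊗ M* ↪ R^(r²)` provided by torsionfreeness. If `𝔪` contains no regular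
element, then `M` is free.
-/

section MinimalGenerators

open IsLocalRing

variable {R N P Q : Type*} [CommRing R] [AddCommGroup N] [Module R N] [AddCommGroup P] [Module R P]
  [AddCommGroup Q] [Module R Q]

theorem numGenerators_le_of_surjective [Module.Finite R P] (f : P →ₗ[R] Q)
    (hf : Function.Surjective f) : numGenerators R Q ≤ numGenerators R P := by
  have h := Submodule.spanFinrank_map_le_of_fg f (Module.Finite.fg_top (R := R) (M := P))
  rwa [Submodule.map_top, LinearMap.range_eq_top.mpr hf] at h

theorem numGenerators_congr [Module.Finite R P] (e : P ≃ₗ[R] Q) :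
    numGenerators R P = numGenerators R Q := by
  have := Module.Finite.equiv e
  exact (numGenerators_le_of_surjective e.symm.toLinearMap e.symm.surjective).antisymm
    (numGenerators_le_of_surjective e.toLinearMap e.surjective)

theorem exists_surjective_of_numGenerators [Module.Finite R P] :
    ∃ f : (Fin (numGenerators R P) → R) →ₗ[R] P, Function.Surjective f := by
  obtain ⟨s, hs, hspan⟩ :=
    (Module.Finite.fg_top (R := R) (M := P)).exists_span_finset_card_eq_spanFinrank
  let e : Fin (numGenerators R P) ≃ s := (finCongr hs.symm).trans s.equivFin.symm
  refine ⟨Fintype.linearCombination R fun i => (e i : P), ?_⟩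
  rw [← LinearMap.range_eq_top, Fintype.range_linearCombination, ← hspan]
  congr 1
  ext x
  simp [e.exists_congr_left]

theorem numGenerators_eq_zero_iff [Module.Finite R P] :
    numGenerators R P = 0 ↔ Subsingleton P := by
  rw [numGenerators, Submodule.spanFinrank_eq_zero_iff_eq_bot Module.Finite.fg_top,
    ← Submodule.subsingleton_iff R, eq_comm]
  exact subsingleton_iff_bot_eq_top

theorem numGenerators_self [Nontrivial R] : numGenerators R R = 1 := by
  rw [numGenerators, ← Module.finrank_eq_spanFinrank_of_free, Module.finrank_self]

theorem map_rid_baseChange (S : Type*) [CommRing S] [Algebra R S] (I : Ideal R) :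
    (I.baseChange S).map (TensorProduct.AlgebraTensorModule.rid R S S).toLinearMap =
      I.map (algebraMap R S) := by
  rw [Submodule.baseChange_eq_span, Submodule.map_span, Ideal.map, Ideal.span]
  congr 1
  ext x
  simp [Algebra.algebraMap_eq_smul_one]

variable [IsLocalRing R]

theorem numGenerators_eq_finrank [Module.Finite R P] :
    numGenerators R P = Module.finrank (ResidueField R) (ResidueField R ⊗[R] P) := by
  have h := TensorProduct.spanFinrank_top_eq_of_residueField (⊤ : Submodule R P)
    Module.Finite.fg_top
  rw [← Module.finrank_eq_spanFinrank_of_free] at h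
  rw [numGenerators, ← h]
  exact (Submodule.topEquiv.baseChange R (ResidueField R) _ _).finrank_eq

theorem length_quotient_maximalIdeal_smul [Module.Finite R P] :
    Module.length R (P ⧸ (maximalIdeal R • ⊤ : Submodule R P)) = numGenerators R P := by
  rw [numGenerators_eq_finrank, ← Module.length_eq_finrank,
    ← Module.length_eq_of_surjective (S := R) (R := ResidueField R) residue_surjective]
  exact (TensorProduct.quotTensorEquivQuotSMul P (maximalIdeal R)).symm.length_eq

theorem numGenerators_le_add_of_exact [Module.Finite R N] [Module.Finite R P] [Module.Finite R Q]
    {f : N →ₗ[R] P} {g : P →ₗ[R] Q} (h : Function.Exact f g) (hg : Function.Surjective g) :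
    numGenerators R P ≤ numGenerators R N + numGenerators R Q := by
  simp only [numGenerators_eq_finrank]
  set k := ResidueField R
  have hexact : Function.Exact (f.baseChange k) (g.baseChange k) := lTensor_exact k h hg
  rw [← (g.baseChange k).finrank_range_add_finrank_ker, LinearMap.exact_iff.mp hexact, add_comm]
  exact Nat.add_le_add (LinearMap.finrank_range_le _) (Submodule.finrank_le _)

theorem numGenerators_pi [Module.Finite R P] (n : ℕ) :
    numGenerators R (Fin n → P) = n * numGenerators R P := by
  simp only [numGenerators_eq_finrank]
  rw [(TensorProduct.piRight R (ResidueField R) (ResidueField R) fun _ : Fin n => P).finrank_eq,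
    Module.finrank_pi_fintype, Finset.sum_const, Finset.card_univ, Fintype.card_fin, smul_eq_mul]

theorem numGenerators_tensorProduct [Module.Finite R P] [Module.Finite R Q] :
    numGenerators R (P ⊗[R] Q) = numGenerators R P * numGenerators R Q := by
  simp only [numGenerators_eq_finrank]
  rw [(TensorProduct.AlgebraTensorModule.distribBaseChange R (ResidueField R) P Q).finrank_eq,
    Module.finrank_tensorProduct]

variable (S : Type*) [CommRing S] [IsLocalRing S] [Algebra R S]

theorem numGenerators_baseChange [IsLocalHom (algebraMap R S)] [Module.Finite R P] :
    numGenerators S (S ⊗[R] P) = numGenerators R P := by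
  rw [numGenerators_eq_finrank, numGenerators_eq_finrank,
    ← Module.finrank_baseChange (R := ResidueField S) (S := ResidueField R),
    (TensorProduct.AlgebraTensorModule.cancelBaseChange R S (ResidueField S) (ResidueField S)
      P).finrank_eq,
    (TensorProduct.AlgebraTensorModule.cancelBaseChange R (ResidueField R) (ResidueField S)
      (ResidueField S) P).finrank_eq]

theorem numGenerators_map_of_flat [IsNoetherianRing R] [Module.Flat R S]
    [IsLocalHom (algebraMap R S)] (I : Ideal R) :
    numGenerators S (I.map (algebraMap R S)) = numGenerators R I := by
  let e := Submodule.toBaseChange.toLinearEquiv S I ≪≫ₗ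
    (TensorProduct.AlgebraTensorModule.rid R S S).submoduleMap _
  rw [← map_rid_baseChange S I, ← numGenerators_congr e, numGenerators_baseChange]

end MinimalGenerators

section CokernelLength

variable {R X Y Z : Type*} [CommRing R] [AddCommGroup X] [Module R X] [AddCommGroup Y] [Module R Y]
  [AddCommGroup Z] [Module R Z]

/-- The length of the cokernel of a linear map, as an extended natural number. For multiplication
by `y` on `Y` it is the length of `Y / yY`, which bounds `ν(Y)` when `y` lies in the
maximal ideal and, for `Y` Noetherian, is not exceeded by that of any submodule. -/
noncomputable def cokernelLength (f : X →ₗ[R] Y) : ℕ∞ :=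
  Module.length R (Y ⧸ LinearMap.range f)

theorem cokernelLength_le_of_range_le {f : X →ₗ[R] Z} {g : Y →ₗ[R] Z}
    (h : LinearMap.range f ≤ LinearMap.range g) : cokernelLength g ≤ cokernelLength f :=
  Module.length_le_of_surjective (Submodule.factor h) (Submodule.factor_surjective h)

theorem cokernelLength_prodMap (f : X →ₗ[R] X) (g : Y →ₗ[R] Y) :
    cokernelLength (f.prodMap g) = cokernelLength f + cokernelLength g := by
  let q := (LinearMap.range f).mkQ.prodMap (LinearMap.range g).mkQ
  have hq : Function.Surjective q :=
    (Submodule.mkQ_surjective _).prodMap (Submodule.mkQ_surjective _)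
  have hker : LinearMap.ker q = LinearMap.range (f.prodMap g) := by
    rw [LinearMap.ker_prodMap, Submodule.ker_mkQ, Submodule.ker_mkQ, LinearMap.range_prodMap]
  rw [cokernelLength, ← hker, (q.quotKerEquivOfSurjective hq).length_eq, Module.length_prod]
  rfl

theorem cokernelLength_compLeft (f : X →ₗ[R] Y) (ι : Type*) [Finite ι] :
    cokernelLength (f.compLeft ι) = ENat.card ι * cokernelLength f := by
  have := Fintype.ofFinite ι
  let q := (LinearMap.range f).mkQ.compLeft ι
  have hq : Function.Surjective q := (Submodule.mkQ_surjective _).comp_left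
  have hker : LinearMap.ker q = LinearMap.range (f.compLeft ι) := by
    rw [LinearMap.ker_compLeft, LinearMap.range_compLeft, Submodule.ker_mkQ]
  rw [cokernelLength, ← hker, (q.quotKerEquivOfSurjective hq).length_eq, Module.length_pi]
  rfl

theorem length_le_add_of_exact {f : X →ₗ[R] Y} {g : Y →ₗ[R] Z} (h : Function.Exact f g)
    (hg : Function.Surjective g) : Module.length R Y ≤ Module.length R X + Module.length R Z := by
  rw [Module.length_eq_add_of_exact (LinearMap.range f).subtype g (Submodule.subtype_injective _) hg
    (h.linearMap_ker_eq ▸ LinearMap.exact_subtype_ker_map g)]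
  gcongr
  exact Module.length_le_of_surjective f.rangeRestrict f.surjective_rangeRestrict

section Composition

variable (f : X →ₗ[R] Y) (g : Y →ₗ[R] Z)

theorem range_le_comap_range_comp :
    LinearMap.range f ≤ (LinearMap.range (g ∘ₗ f)).comap g := by
  rintro _ ⟨x, rfl⟩
  exact ⟨x, rfl⟩

theorem exact_mapQ_factor_range_comp :
    Function.Exact (Submodule.mapQ _ _ g (range_le_comap_range_comp f g))
      (Submodule.factor (LinearMap.range_comp_le_range f g)) := by
  rw [LinearMap.exact_iff, Submodule.range_mapQ, Submodule.factor, Submodule.ker_mapQ,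
    Submodule.comap_id]

theorem cokernelLength_comp_le :
    cokernelLength (g ∘ₗ f) ≤ cokernelLength f + cokernelLength g :=
  length_le_add_of_exact (exact_mapQ_factor_range_comp f g) (Submodule.factor_surjective _)

theorem cokernelLength_comp_of_injective (hg : Function.Injective g) :
    cokernelLength (g ∘ₗ f) = cokernelLength f + cokernelLength g := by
  refine Module.length_eq_add_of_exact _ _ ?_ (Submodule.factor_surjective _)
    (exact_mapQ_factor_range_comp f g)
  rw [← LinearMap.ker_eq_bot, Submodule.ker_mapQ, LinearMap.range_comp,
    Submodule.comap_map_eq_of_injective hg, Submodule.mkQ_map_self]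

end Composition

theorem cokernelLength_pow_ne_top {φ : Y →ₗ[R] Y} (hφ : cokernelLength φ ≠ ⊤) (n : ℕ) :
    cokernelLength (φ ^ n) ≠ ⊤ := by
  induction n with
  | zero =>
    have : Subsingleton (Y ⧸ LinearMap.range (φ ^ 0)) := by
      rw [Submodule.Quotient.subsingleton_iff, pow_zero]
      exact LinearMap.range_id
    rw [cokernelLength, Module.length_eq_zero]
    exact ENat.zero_ne_top
  | succ n ih =>
    rw [pow_succ]
    exact ne_top_of_le_ne_top (WithTop.add_ne_top.mpr ⟨hφ, ih⟩) (cokernelLength_comp_le φ (φ ^ n))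

theorem cokernelLength_le_of_cokernelLength_ne_top {j : X →ₗ[R] Y} (hj : Function.Injective j)
    (hfin : cokernelLength j ≠ ⊤) {φ : Y →ₗ[R] Y} {ψ : X →ₗ[R] X} (h : φ ∘ₗ j = j ∘ₗ ψ) :
    cokernelLength ψ ≤ cokernelLength φ := by
  have hle := cokernelLength_comp_le j φ
  rw [h, cokernelLength_comp_of_injective ψ j hj, add_comm] at hle
  exact (ENat.add_le_add_iff_left hfin).mp hle

theorem cokernelLength_restrict_le_of_comap_eq {P : Submodule R Y} {φ : Y →ₗ[R] Y}
    (hP : P.comap φ = P) : cokernelLength (φ.restrict hP.ge) ≤ cokernelLength φ := by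
  have hrange : LinearMap.range (φ.restrict hP.ge) ≤ (LinearMap.range φ).comap P.subtype := by
    rintro _ ⟨x, rfl⟩
    exact ⟨x, rfl⟩
  refine Module.length_le_of_injective (Submodule.mapQ _ _ P.subtype hrange) ?_
  rw [← LinearMap.ker_eq_bot, Submodule.ker_mapQ, eq_bot_iff, Submodule.map_le_iff_le_comap,
    Submodule.comap_bot, Submodule.ker_mkQ]
  rintro ⟨_, hy⟩ ⟨x, rfl⟩
  exact ⟨⟨x, hP ▸ hy⟩, rfl⟩

theorem exists_comap_eq_self [IsNoetherian R Y] {φ : Y →ₗ[R] Y} {P : Submodule R Y}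
    (hP : P ≤ P.comap φ) :
    ∃ P' : Submodule R Y, P ≤ P' ∧ P'.comap φ = P' ∧ ∃ n, P' ≤ P.comap (φ ^ n) := by
  have hmono : Monotone fun n : ℕ => P.comap (φ ^ n) := monotone_nat_of_le_succ fun n => by
    rw [pow_succ', Module.End.mul_eq_comp, Submodule.comap_comp]
    exact Submodule.comap_mono hP
  obtain ⟨n, hn⟩ := monotone_stabilizes_iff_noetherian.mpr ‹_› ⟨_, hmono⟩
  refine ⟨P.comap (φ ^ n), hmono n.zero_le, ?_, n, le_rfl⟩
  rw [← Submodule.comap_comp, ← Module.End.mul_eq_comp, ← pow_succ]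
  exact (hn (n + 1) n.le_succ).symm

theorem cokernelLength_le_of_injective [IsNoetherian R Y] {f : X →ₗ[R] Y}
    (hf : Function.Injective f) {φ : Y →ₗ[R] Y} {ψ : X →ₗ[R] X} (h : φ ∘ₗ f = f ∘ₗ ψ) :
    cokernelLength ψ ≤ cokernelLength φ := by
  by_cases hfin : cokernelLength φ = ⊤
  · exact hfin ▸ le_top
  -- `P` consists of the elements that some power of `φ` sends into `X`: the map induced by `φ` is
  -- injective on `Y / P`, while `P / X` has finite length.
  obtain ⟨P, hfP, hP, n, hn⟩ := exists_comap_eq_self (φ := φ) (P := LinearMap.range f) <| by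
    rintro _ ⟨x, rfl⟩
    exact ⟨ψ x, (LinearMap.congr_fun h x).symm⟩
  let j : X →ₗ[R] P := f.codRestrict P fun x => hfP ⟨x, rfl⟩
  have hj : Function.Injective j := fun a b hab => hf (congrArg P.subtype hab)
  let φP : P →ₗ[R] P := φ.restrict hP.ge
  have hφP : cokernelLength φP ≤ cokernelLength φ := cokernelLength_restrict_le_of_comap_eq hP
  have hrange : LinearMap.range (φP ^ n) ≤ LinearMap.range j := by
    rintro _ ⟨y, rfl⟩
    obtain ⟨x, hx⟩ := hn y.2
    refine ⟨x, Subtype.ext (hx.trans ?_)⟩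
    rw [Module.End.pow_restrict]
    rfl
  have hjfin : cokernelLength j ≠ ⊤ := ne_top_of_le_ne_top
    (cokernelLength_pow_ne_top (ne_top_of_le_ne_top hfin hφP) n)
    (cokernelLength_le_of_range_le hrange)
  have hcomm : φP ∘ₗ j = j ∘ₗ ψ := LinearMap.ext fun x => Subtype.ext (LinearMap.congr_fun h x)
  exact (cokernelLength_le_of_cokernelLength_ne_top hj hjfin hcomm).trans hφP

end CokernelLength

section Reduction

open IsLocalRing

variable {R N : Type*} [CommRing R] [IsLocalRing R] [AddCommGroup N] [Module R N] {y : R}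
  {k : ℕ}

theorem numGenerators_le_cokernelLength_lsmul [Module.Finite R N] (hy : y ∈ maximalIdeal R) :
    (numGenerators R N : ℕ∞) ≤ cokernelLength (LinearMap.lsmul R N y) := by
  rw [← length_quotient_maximalIdeal_smul]
  refine Module.length_le_of_surjective (Submodule.factor ?_) (Submodule.factor_surjective _)
  rintro _ ⟨x, rfl⟩
  exact Submodule.smul_mem_smul hy Submodule.mem_top

variable [IsNoetherianRing R]

theorem cokernelLength_lsmul_maximalIdeal_pow
    (hred : Ideal.span {y} * maximalIdeal R ^ k = maximalIdeal R ^ (k + 1)) :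
    cokernelLength (LinearMap.lsmul R ↥(maximalIdeal R ^ k) y) =
      numGenerators R ↥(maximalIdeal R ^ k) := by
  have hrange : LinearMap.range (LinearMap.lsmul R ↥(maximalIdeal R ^ k) y) =
      maximalIdeal R • ⊤ := by
    apply Submodule.map_injective_of_injective (maximalIdeal R ^ k).subtype_injective
    rw [Submodule.map_smul'', Submodule.map_top, Submodule.range_subtype, smul_eq_mul, ← pow_succ',
      ← hred, ← LinearMap.range_comp]
    ext x
    simp [Ideal.mem_span_singleton_mul, eq_comm]
  rw [cokernelLength, hrange, length_quotient_maximalIdeal_smul]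

theorem cokernelLength_lsmul_self (hy : IsSMulRegular R y) (hmem : y ∈ maximalIdeal R)
    (hred : Ideal.span {y} * maximalIdeal R ^ k = maximalIdeal R ^ (k + 1)) :
    cokernelLength (LinearMap.lsmul R R y) = numGenerators R ↥(maximalIdeal R ^ k) := by
  rw [← cokernelLength_lsmul_maximalIdeal_pow hred]
  apply le_antisymm
  · let f : R →ₗ[R] ↥(maximalIdeal R ^ k) :=
      LinearMap.toSpanSingleton R _ ⟨y ^ k, Ideal.pow_mem_pow hmem k⟩
    have hf : Function.Injective f := fun a b hab => by
      apply hy.pow k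
      simpa [f, mul_comm] using hab
    exact cokernelLength_le_of_injective hf (LinearMap.ext fun x => (map_smul f y x).symm)
  · exact cokernelLength_le_of_injective (maximalIdeal R ^ k).subtype_injective
      (LinearMap.ext fun x => (map_smul (maximalIdeal R ^ k).subtype y x).symm)

theorem numGenerators_maximalIdeal_pow_succ_le
    (hred : Ideal.span {y} * maximalIdeal R ^ k = maximalIdeal R ^ (k + 1)) :
    numGenerators R ↥(maximalIdeal R ^ (k + 1)) ≤ numGenerators R ↥(maximalIdeal R ^ k) := by
  have hle : ∀ x ∈ maximalIdeal R ^ k, LinearMap.lsmul R R y x ∈ maximalIdeal R ^ (k + 1) :=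
    fun x hx => hred ▸ Ideal.mem_span_singleton_mul.mpr ⟨x, hx, rfl⟩
  refine numGenerators_le_of_surjective ((LinearMap.lsmul R R y).restrict hle) ?_
  rintro ⟨x, hx⟩
  obtain ⟨z, hz, rfl⟩ := Ideal.mem_span_singleton_mul.mp (hred ▸ hx)
  exact ⟨⟨z, hz⟩, rfl⟩

theorem numGenerators_add_le_of_reduction [Module.Finite R N] {r m : ℕ}
    (hy : IsSMulRegular R y) (hmem : y ∈ maximalIdeal R)
    (hred : Ideal.span {y} * maximalIdeal R ^ k = maximalIdeal R ^ (k + 1))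
    {f : N × (Fin r → R) →ₗ[R] Fin m → R} (hf : Function.Injective f) :
    numGenerators R N + r * numGenerators R ↥(maximalIdeal R ^ k) ≤
      m * numGenerators R ↥(maximalIdeal R ^ k) := by
  have hcomm : ((LinearMap.lsmul R R y).compLeft (Fin m)) ∘ₗ f =
      f ∘ₗ (LinearMap.lsmul R N y).prodMap ((LinearMap.lsmul R R y).compLeft (Fin r)) :=
    LinearMap.ext fun x => (map_smul f y x).symm
  have hle := cokernelLength_le_of_injective hf hcomm
  rw [cokernelLength_prodMap, cokernelLength_compLeft, cokernelLength_compLeft,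
    cokernelLength_lsmul_self hy hmem hred, ENat.card_eq_coe_fintype_card,
    ENat.card_eq_coe_fintype_card, Fintype.card_fin, Fintype.card_fin] at hle
  exact_mod_cast (add_le_add_left (numGenerators_le_cokernelLength_lsmul hmem) _).trans hle

end Reduction

section GenericExtension

open IsLocalRing Polynomial

variable (R : Type*) [CommRing R] [IsLocalRing R]

/-- The ring `R(X)`, the localization of `R[X]` at the extension of the maximal ideal of `R`. It is
a flat local extension of `R` whose maximal ideal is generated by that of `R`, so that minimal
numbers of generators do not change, while its infinite residue field provides elements in general
position. -/
abbrev GenericExtension : Type _ :=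
  Localization.AtPrime ((maximalIdeal R).map (C : R →+* R[X]))

namespace GenericExtension

instance : Module.Flat R (GenericExtension R) :=
  have : Module.Flat R[X] (GenericExtension R) :=
    IsLocalization.flat _ ((maximalIdeal R).map (C : R →+* R[X])).primeCompl
  Module.Flat.trans R R[X] _

instance [IsNoetherianRing R] : IsNoetherianRing (GenericExtension R) :=
  IsLocalization.isNoetherianRing ((maximalIdeal R).map (C : R →+* R[X])).primeCompl _ inferInstance

theorem map_maximalIdeal :
    (maximalIdeal R).map (algebraMap R (GenericExtension R)) =
      maximalIdeal (GenericExtension R) := by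
  rw [← Localization.AtPrime.map_eq_maximalIdeal, Ideal.map_map]
  rfl

instance : IsLocalHom (algebraMap R (GenericExtension R)) :=
  ((local_hom_TFAE _).out 2 0).mp (map_maximalIdeal R).le

variable {R}

theorem isUnit_X_pow_sub {i j : ℕ} (hij : i ≠ j) :
    IsUnit (algebraMap R[X] (GenericExtension R) X ^ i - algebraMap R[X] _ X ^ j) := by
  rw [← map_pow, ← map_pow, ← map_sub, IsLocalization.AtPrime.isUnit_to_map_iff _
    ((maximalIdeal R).map (C : R →+* R[X])), Ideal.mem_primeCompl_iff, Ideal.mem_map_C_iff]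
  intro h
  have h1 := h i
  simp [coeff_X_pow, hij] at h1

theorem numGenerators_maximalIdeal_pow [IsNoetherianRing R] (k : ℕ) :
    numGenerators (GenericExtension R) ↥(maximalIdeal (GenericExtension R) ^ k) =
      numGenerators R ↥(maximalIdeal R ^ k) := by
  rw [← map_maximalIdeal, ← Ideal.map_pow, numGenerators_map_of_flat]

end GenericExtension

end GenericExtension

section EakinSathaye

variable {S V : Type*} [CommRing S] [AddCommGroup V] [Module S V]

theorem length_le_of_lt {P Q : Submodule S V} (h : P < Q) {n : ℕ}
    (hQ : Module.length S Q ≤ n + 1) : Module.length S P ≤ n := by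
  rw [Module.length_submodule] at hQ ⊢
  have hP : Order.height P ≠ ⊤ :=
    ne_top_of_le_ne_top (ENat.natCast_ne_top (n + 1)) ((Order.height_mono h.le).trans hQ)
  exact Order.le_of_lt_add_one ((Order.height_strictMono h hP.lt_top).trans_le hQ)

variable {I : Ideal S} {y : ℕ → S}

theorem smul_le_of_infinite (hy : ∀ Z : Set ℕ, Z.Infinite → Ideal.span (y '' Z) = I)
    {Z : Set ℕ} (hZ : Z.Infinite) {P Q : Submodule S V}
    (h : ∀ j ∈ Z, Ideal.span {y j} • P ≤ Q) : I • P ≤ Q := by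
  rw [← hy Z hZ, ← Set.biUnion_of_singleton (y '' Z), Ideal.span, Submodule.span_iUnion₂]
  simp only [Submodule.iSup_smul, iSup_le_iff]
  rintro _ ⟨j, hj, rfl⟩
  exact h j hj

theorem span_singleton_smul_pow_smul_le
    (hy : ∀ Z : Set ℕ, Z.Infinite → Ideal.span (y '' Z) = I) (j n : ℕ) (W : Submodule S V) :
    Ideal.span {y j} • I ^ n • W ≤ I ^ (n + 1) • W := by
  rw [pow_succ', mul_smul, ← hy Set.univ Set.infinite_univ]
  exact Submodule.smul_mono_left (Ideal.span_mono (by simp))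

theorem finite_setOf_span_singleton_smul_ne
    (hy : ∀ Z : Set ℕ, Z.Infinite → Ideal.span (y '' Z) = I) {W : Submodule S V}
    (hlen : Module.length S ↥(I • W) ≤ 1) :
    {j | Ideal.span {y j} • W ≠ I • W}.Finite := by
  by_contra hZ
  have hle (j : ℕ) : Ideal.span {y j} • W ≤ I • W := by
    simpa using span_singleton_smul_pow_smul_le hy j 0 W
  have hbot (j : ℕ) (hj : Ideal.span {y j} • W ≠ I • W) : Ideal.span {y j} • W = ⊥ := by
    have hlen0 := length_le_of_lt ((hle j).lt_of_ne hj) (n := 0) (by simpa using hlen)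
    rwa [Nat.cast_zero, nonpos_iff_eq_zero, Module.length_eq_zero_iff,
      Submodule.subsingleton_iff_eq_bot] at hlen0
  obtain ⟨j, hj⟩ := Set.Infinite.nonempty hZ
  refine hj ?_
  rw [hbot j hj, eq_comm, ← le_bot_iff]
  exact smul_le_of_infinite hy hZ fun j hj => (hbot j hj).le

theorem finite_setOf_span_singleton_smul_pow_smul_ne [IsNoetherian S V]
    (hy : ∀ Z : Set ℕ, Z.Infinite → Ideal.span (y '' Z) = I) (n : ℕ)
    (W : Submodule S V) (hlen : Module.length S ↥(I ^ (n + 1) • W) ≤ n + 1) :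
    {j | Ideal.span {y j} • I ^ n • W ≠ I ^ (n + 1) • W}.Finite := by
  induction n generalizing W with
  | zero =>
    rw [zero_add, pow_one, Nat.cast_zero, zero_add] at hlen
    simpa using finite_setOf_span_singleton_smul_ne hy hlen
  | succ n ih =>
    by_contra hZ
    set Z : Set ℕ := {j | Ideal.span {y j} • I ^ (n + 1) • W ≠ I ^ (n + 1 + 1) • W}
    have hgood (j : ℕ) (hj : j ∈ Z) : {s | Ideal.span {y s} • I ^ n • Ideal.span {y j} • W ≠
        I ^ (n + 1) • Ideal.span {y j} • W}.Finite := by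
      refine ih _ ?_
      rw [smul_comm]
      exact length_le_of_lt ((span_singleton_smul_pow_smul_le hy j (n + 1) W).lt_of_ne hj) hlen
    -- Maximality of `y_j Iⁿ⁺¹ W` makes it equal to `y_s Iⁿ⁺¹ W` for infinitely many `s`, and the
    -- corresponding `y_s` still generate `I`.
    obtain ⟨_, ⟨j, hj, rfl⟩, hmax⟩ := set_has_maximal_iff_noetherian.mpr ‹IsNoetherian S V›
      ((fun j => Ideal.span {y j} • I ^ (n + 1) • W) '' Z) (Set.Infinite.nonempty hZ |>.image _)
    refine hj ((span_singleton_smul_pow_smul_le hy j (n + 1) W).antisymm ?_)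
    rw [pow_succ' I (n + 1), mul_smul]
    refine smul_le_of_infinite hy (Set.Infinite.sdiff hZ (hgood j hj)) fun s hs => ?_
    have heq : Ideal.span {y s} • I ^ n • Ideal.span {y j} • W =
        I ^ (n + 1) • Ideal.span {y j} • W := not_not.mp hs.2
    have hle : Ideal.span {y j} • I ^ (n + 1) • W ≤ Ideal.span {y s} • I ^ (n + 1) • W := by
      rw [smul_comm, ← heq, smul_comm (I ^ n)]
      exact smul_mono_right _ (span_singleton_smul_pow_smul_le hy j n W)
    exact (eq_of_le_of_not_lt hle (hmax _ ⟨s, hs.1, rfl⟩)).ge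

end EakinSathaye

section MomentCurve

variable {S : Type*} [CommRing S] {g : ℕ}

/-- The point with parameter `t` on the moment curve `t ↦ x₀ + t x₁ + ⋯ + t ^ (g - 1) x_{g-1}`,
used to produce elements of an ideal in general position. -/
def momentCurve (x : Fin g → S) (t : S) : S := ∑ i : Fin g, t ^ (i : ℕ) * x i

theorem momentCurve_mem_span (x : Fin g → S) (t : S) :
    momentCurve x t ∈ Ideal.span (Set.range x) :=
  Ideal.sum_mem _ fun i _ => Ideal.mul_mem_left _ _ (Ideal.subset_span ⟨i, rfl⟩)

theorem isUnit_det_vandermonde {v : Fin g → S} (hv : ∀ i j, i ≠ j → IsUnit (v i - v j)) :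
    IsUnit (Matrix.vandermonde v).det := by
  rw [Matrix.det_vandermonde]
  exact IsUnit.prod_univ_iff.mpr fun i => IsUnit.prod_iff.mpr fun j hj =>
    hv j i (Finset.mem_Ioi.mp hj).ne'

theorem span_range_le_span_range_momentCurve (x : Fin g → S) {v : Fin g → S}
    (hv : ∀ i j, i ≠ j → IsUnit (v i - v j)) :
    Ideal.span (Set.range x) ≤ Ideal.span (Set.range fun i => momentCurve x (v i)) := by
  have hcurve : (fun i => momentCurve x (v i)) = (Matrix.vandermonde v).mulVec x := rfl
  have hx : x = (Matrix.vandermonde v)⁻¹.mulVec fun i => momentCurve x (v i) := by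
    rw [hcurve, Matrix.mulVec_mulVec, Matrix.nonsing_inv_mul _ (isUnit_det_vandermonde hv),
      Matrix.one_mulVec]
  rw [Ideal.span_le]
  rintro _ ⟨i, rfl⟩
  rw [SetLike.mem_coe, congrFun hx i, Matrix.mulVec, dotProduct]
  exact Ideal.sum_mem _ fun j _ =>
    Ideal.mul_mem_left _ _ (Ideal.subset_span (Set.mem_range_self j))

theorem span_momentCurve_image_of_infinite (x : Fin g → S) {t : ℕ → S}
    (ht : ∀ i j, i ≠ j → IsUnit (t i - t j)) {Z : Set ℕ} (hZ : Z.Infinite) :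
    Ideal.span ((fun j => momentCurve x (t j)) '' Z) = Ideal.span (Set.range x) := by
  apply le_antisymm
  · rw [Ideal.span_le]
    rintro _ ⟨j, -, rfl⟩
    exact momentCurve_mem_span x (t j)
  · let a : Fin g ↪ Z := Fin.valEmbedding.trans (hZ.natEmbedding Z)
    have ha (i j : Fin g) (hij : i ≠ j) : IsUnit (t (a i) - t (a j)) :=
      ht _ _ fun h => hij (a.injective (Subtype.ext h))
    refine (span_range_le_span_range_momentCurve x ha).trans (Ideal.span_mono ?_)
    rintro _ ⟨i, rfl⟩
    exact ⟨a i, (a i).2, rfl⟩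

end MomentCurve

section PrincipalReduction

open IsLocalRing

variable {R : Type*} [CommRing R]

theorem smul_top_quotient (I J : Ideal R) :
    (J • ⊤ : Submodule R (R ⧸ I)) = Submodule.map I.mkQ J := by
  rw [← Submodule.range_mkQ I, ← Submodule.map_top, ← Submodule.map_smul'', smul_eq_mul,
    Ideal.mul_top]

variable [IsLocalRing R] [IsNoetherianRing R]

theorem length_map_mkQ_maximalIdeal_mul_le (I : Ideal R) :
    Module.length R (Submodule.map (maximalIdeal R * I).mkQ I) ≤ numGenerators R I := by
  let f : I →ₗ[R] R ⧸ maximalIdeal R * I := (maximalIdeal R * I).mkQ ∘ₗ I.subtype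
  have hf : (maximalIdeal R • ⊤ : Submodule R I) ≤ LinearMap.ker f := by
    rw [LinearMap.ker_comp, Submodule.ker_mkQ, ← Submodule.map_le_iff_le_comap,
      Submodule.map_smul'', Submodule.map_top, Submodule.range_subtype, smul_eq_mul]
  have hrange : LinearMap.range (Submodule.liftQ _ f hf) =
      Submodule.map (maximalIdeal R * I).mkQ I := by
    rw [Submodule.range_liftQ, LinearMap.range_comp, Submodule.range_subtype]
  rw [← hrange, ← length_quotient_maximalIdeal_smul]
  exact Module.length_le_of_surjective _ (LinearMap.surjective_rangeRestrict _)

theorem exists_span_singleton_mul_maximalIdeal_pow_eq {y : ℕ → R}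
    (hy : ∀ Z : Set ℕ, Z.Infinite → Ideal.span (y '' Z) = maximalIdeal R) {c : ℕ}
    (hc : numGenerators R ↥(maximalIdeal R ^ (c + 1)) ≤ c + 1) :
    ∃ j, Ideal.span {y j} * maximalIdeal R ^ c = maximalIdeal R ^ (c + 1) := by
  set I := maximalIdeal R ^ (c + 1)
  have hlen : Module.length R
      ↥(I • ⊤ : Submodule R (R ⧸ maximalIdeal R * I)) ≤ c + 1 := by
    rw [smul_top_quotient]
    exact (length_map_mkQ_maximalIdeal_mul_le I).trans (by exact_mod_cast hc)
  obtain ⟨j, hj⟩ := (finite_setOf_span_singleton_smul_pow_smul_ne hy c ⊤ hlen).exists_notMem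
  have heq := not_not.mp hj
  rw [← mul_smul, smul_top_quotient, smul_top_quotient] at heq
  refine ⟨j, le_antisymm ?_ ?_⟩
  · simpa only [smul_eq_mul, Ideal.mul_top] using
      span_singleton_smul_pow_smul_le hy j c (⊤ : Ideal R)
  · apply Submodule.le_of_le_smul_of_le_jacobson_bot (IsNoetherian.noetherian I)
      (maximalIdeal_le_jacobson ⊥)
    rw [smul_eq_mul, ← Submodule.ker_mkQ (maximalIdeal R * I), ← Submodule.comap_map_eq,
      ← Submodule.map_le_iff_le_comap]
    exact heq.ge

theorem exists_reduction_genericExtension {c : ℕ}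
    (hc : numGenerators R ↥(maximalIdeal R ^ (c + 1)) ≤ c + 1) :
    ∃ y ∈ maximalIdeal (GenericExtension R), ∀ k ≥ c,
      Ideal.span {y} * maximalIdeal (GenericExtension R) ^ k =
        maximalIdeal (GenericExtension R) ^ (k + 1) := by
  obtain ⟨g, x, hx⟩ := Submodule.fg_iff_exists_fin_generating_family.mp
    (IsNoetherian.noetherian (maximalIdeal (GenericExtension R)))
  let t : ℕ → GenericExtension R := fun j => algebraMap _ _ (Polynomial.X : Polynomial R) ^ j
  have ht : ∀ i j, i ≠ j → IsUnit (t i - t j) := fun i j =>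
    GenericExtension.isUnit_X_pow_sub
  have hspan (Z : Set ℕ) (hZ : Z.Infinite) := (span_momentCurve_image_of_infinite x ht hZ).trans hx
  rw [← GenericExtension.numGenerators_maximalIdeal_pow] at hc
  obtain ⟨j, hj⟩ := exists_span_singleton_mul_maximalIdeal_pow_eq hspan hc
  refine ⟨momentCurve x (t j), hx ▸ momentCurve_mem_span x (t j), fun k hk => ?_⟩
  obtain ⟨i, rfl⟩ := Nat.exists_eq_add_of_le hk
  rw [pow_add, ← mul_assoc, hj, ← pow_add]
  congr 1
  ring

end PrincipalReduction

section Multiplicity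

open IsLocalRing Filter Topology

variable {R : Type*} [CommRing R] [IsLocalRing R]

theorem maximalIdeal_notMem_minimalPrimes (hdim : ringKrullDim R = 1) :
    maximalIdeal R ∉ minimalPrimes R := by
  intro h
  have h0 : Ring.KrullDimLE 0 R := Ring.KrullDimLE.mk₀ fun p hp => by
    have hle : maximalIdeal R ≤ p := h.2 ⟨hp, bot_le⟩ (le_maximalIdeal hp.ne_top)
    rw [(le_maximalIdeal hp.ne_top).antisymm hle]
    infer_instance
  have hle := (Ring.krullDimLE_iff (n := 0) (R := R)).mp h0
  rw [hdim] at hle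
  exact absurd hle (by decide)

theorem maximalIdeal_pow_ne_bot (hdim : ringKrullDim R = 1) (k : ℕ) : maximalIdeal R ^ k ≠ ⊥ :=
  fun h => maximalIdeal_notMem_minimalPrimes hdim ⟨⟨inferInstance, bot_le⟩, fun _ hp _ =>
    have := hp.1
    Ideal.IsPrime.le_of_pow_le (n := k) (h ▸ bot_le)⟩

variable [IsNoetherianRing R]

theorem exists_mem_maximalIdeal_forall_notMem_minimalPrimes (hdim : ringKrullDim R = 1) :
    ∃ x ∈ maximalIdeal R, ∀ p ∈ minimalPrimes R, x ∉ p := by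
  by_contra! hcover
  have hsub : (maximalIdeal R : Set R) ⊆ ⋃ p ∈ minimalPrimes R, (p : Set R) := fun x hx => by
    obtain ⟨p, hp, hxp⟩ := hcover x hx
    exact Set.mem_biUnion hp hxp
  obtain ⟨p, hp, hle⟩ := (Ideal.subset_union_prime_finite
    (minimalPrimes.finite_of_isNoetherianRing R) (f := id) 0 0 fun _ h _ _ => h.1.1).mp hsub
  refine maximalIdeal_notMem_minimalPrimes hdim ?_
  rwa [hle.antisymm (le_maximalIdeal hp.1.1.ne_top)]

theorem krullDimLE_zero_quotient_span_singleton {A : Type*} [CommRing A] [Ring.KrullDimLE 1 A]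
    {x : A} (hx : ∀ p ∈ minimalPrimes A, x ∉ p) : Ring.KrullDimLE 0 (A ⧸ Ideal.span {x}) := by
  refine Ring.KrullDimLE.mk₀ fun P hP => ?_
  let π := Ideal.Quotient.mk (Ideal.span {x})
  have hπ : Function.Surjective π := Ideal.Quotient.mk_surjective
  have hmem : x ∈ P.comap π := by
    rw [Ideal.mem_comap, Ideal.Quotient.eq_zero_iff_mem.mpr (Ideal.mem_span_singleton_self x)]
    exact P.zero_mem
  have hmax : (P.comap π).IsMaximal :=
    (Ring.krullDimLE_one_iff.mp ‹_› _ (Ideal.comap_isPrime π P)).resolve_left fun h => hx _ h hmem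
  rw [← Ideal.map_comap_of_surjective π hπ P]
  refine (Ideal.map_eq_top_or_isMaximal_of_surjective π hπ hmax).resolve_left ?_
  rw [Ideal.map_comap_of_surjective π hπ P]
  exact hP.ne_top

theorem exists_mem_maximalIdeal_cokernelLength_ne_top (hdim : ringKrullDim R = 1) :
    ∃ x ∈ maximalIdeal R, cokernelLength (LinearMap.lsmul R R x) ≠ ⊤ := by
  obtain ⟨x, hx, hmin⟩ := exists_mem_maximalIdeal_forall_notMem_minimalPrimes hdim
  refine ⟨x, hx, ?_⟩
  have : Ring.KrullDimLE 1 R := Ring.krullDimLE_iff.mpr hdim.le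
  have : IsArtinianRing (R ⧸ Ideal.span {x}) :=
    isArtinianRing_iff_isNoetherianRing_krullDimLE_zero.mpr
      ⟨inferInstance, krullDimLE_zero_quotient_span_singleton hmin⟩
  have hrange : LinearMap.range (LinearMap.lsmul R R x) = Ideal.span {x} := by
    ext z
    simp [Ideal.mem_span_singleton', mul_comm x]
  rw [cokernelLength, hrange,
    Module.length_eq_of_surjective (R := R ⧸ Ideal.span {x}) Ideal.Quotient.mk_surjective]
  exact Module.length_ne_top

theorem exists_forall_numGenerators_ideal_le (hdim : ringKrullDim R = 1) :
    ∃ c, ∀ I : Ideal R, numGenerators R I ≤ c := by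
  obtain ⟨x, hx, hfin⟩ := exists_mem_maximalIdeal_cokernelLength_ne_top hdim
  refine ⟨(cokernelLength (LinearMap.lsmul R R x)).toNat, fun I => ?_⟩
  rw [← Nat.cast_le (α := ℕ∞), ENat.natCast_toNat hfin]
  exact (numGenerators_le_cokernelLength_lsmul hx).trans
    (cokernelLength_le_of_injective I.subtype_injective
      (LinearMap.ext fun v => (map_smul I.subtype x v).symm))

theorem exists_reduction_of_ringKrullDim_eq_one (hdim : ringKrullDim R = 1) :
    ∃ c, ∃ y ∈ maximalIdeal (GenericExtension R), ∀ k ≥ c,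
      Ideal.span {y} * maximalIdeal (GenericExtension R) ^ k =
        maximalIdeal (GenericExtension R) ^ (k + 1) := by
  obtain ⟨c, hc⟩ := exists_forall_numGenerators_ideal_le hdim
  exact ⟨c, exists_reduction_genericExtension ((hc _).trans c.le_succ)⟩

theorem exists_eventually_numGenerators_maximalIdeal_pow_eq (hdim : ringKrullDim R = 1) :
    ∃ e, ∀ᶠ k in atTop, numGenerators R ↥(maximalIdeal R ^ k) = e := by
  obtain ⟨c, y, -, hy⟩ := exists_reduction_of_ringKrullDim_eq_one hdim
  have hanti : Antitone fun k => numGenerators R ↥(maximalIdeal R ^ (c + k)) :=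
    antitone_nat_of_succ_le fun k => by
      have hle := numGenerators_maximalIdeal_pow_succ_le (hy (c + k) (Nat.le_add_right c k))
      rwa [GenericExtension.numGenerators_maximalIdeal_pow,
        GenericExtension.numGenerators_maximalIdeal_pow] at hle
  obtain ⟨K, hK⟩ := WellFoundedGT.monotone_chain_condition (α := ℕᵒᵈ) ⟨_, hanti.dual_right⟩
  refine ⟨numGenerators R ↥(maximalIdeal R ^ (c + K)), eventually_atTop.mpr ⟨c + K, fun k hk => ?_⟩⟩
  obtain ⟨i, rfl⟩ := Nat.exists_eq_add_of_le hk
  rw [add_assoc]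
  exact (hK (K + i) (Nat.le_add_right K i)).symm

theorem length_quotient_maximalIdeal_pow_succ (k : ℕ) :
    Module.length R (R ⧸ maximalIdeal R ^ (k + 1)) =
      numGenerators R ↥(maximalIdeal R ^ k) + Module.length R (R ⧸ maximalIdeal R ^ k) := by
  have h := cokernelLength_comp_of_injective
    (maximalIdeal R • ⊤ : Submodule R ↥(maximalIdeal R ^ k)).subtype
    (maximalIdeal R ^ k).subtype (maximalIdeal R ^ k).subtype_injective
  rw [cokernelLength, cokernelLength, cokernelLength, LinearMap.range_comp, Submodule.range_subtype,
    Submodule.range_subtype, Submodule.map_smul'', Submodule.map_top, Submodule.range_subtype,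
    smul_eq_mul, length_quotient_maximalIdeal_smul] at h
  rw [pow_succ']
  exact h

theorem length_quotient_maximalIdeal_pow_ne_top (k : ℕ) :
    Module.length R (R ⧸ maximalIdeal R ^ k) ≠ ⊤ := by
  induction k with
  | zero =>
    have : Subsingleton (R ⧸ maximalIdeal R ^ 0) := by
      rw [Ideal.Quotient.subsingleton_iff, pow_zero, Ideal.one_eq_top]
    simp
  | succ k ih =>
    rw [length_quotient_maximalIdeal_pow_succ]
    exact WithTop.add_ne_top.mpr ⟨ENat.natCast_ne_top _, ih⟩

theorem tendsto_div_of_eventually_succ_eq_add {l : ℕ → ℝ} {e : ℝ}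
    (h : ∀ᶠ n in atTop, l (n + 1) = e + l n) : Tendsto (fun n : ℕ => l n / n) atTop (𝓝 e) := by
  obtain ⟨K, hK⟩ := eventually_atTop.mp h
  have hlin (n : ℕ) : l (K + n) = l K + e * n := by
    induction n with
    | zero => simp
    | succ n ih => rw [← add_assoc, hK _ (by omega), ih]; push_cast; ring
  have hlim : Tendsto (fun n : ℕ => (l K - e * K) / n + e) atTop (𝓝 (0 + e)) :=
    (tendsto_const_div_atTop_nhds_zero_nat _).add tendsto_const_nhds
  rw [zero_add] at hlim
  refine hlim.congr' ?_
  filter_upwards [eventually_ge_atTop K, eventually_gt_atTop 0] with n hn hn0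
  obtain ⟨t, rfl⟩ := Nat.exists_eq_add_of_le hn
  have hne : (K + t : ℝ) ≠ 0 := by exact_mod_cast hn0.ne'
  rw [hlin]
  push_cast
  field_simp
  ring

theorem localMultiplicity_eq (hdim : ringKrullDim R = 1) {e : ℕ}
    (h : ∀ᶠ k in atTop, numGenerators R ↥(maximalIdeal R ^ k) = e) : localMultiplicity R = e := by
  have hd : localDim R = 1 := by rw [localDim, hdim]; rfl
  refine Tendsto.limUnder_eq ?_
  simp only [hd, Nat.factorial_one, Nat.cast_one, one_mul, pow_one]
  refine tendsto_div_of_eventually_succ_eq_add (h.mono fun k hk => ?_)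
  rw [length_quotient_maximalIdeal_pow_succ, hk, ENat.toNat_add (ENat.natCast_ne_top _)
    (length_quotient_maximalIdeal_pow_ne_top k), ENat.toNat_natCast, Nat.cast_add]

theorem exists_localMultiplicity_eq (hdim : ringKrullDim R = 1) :
    ∃ e : ℕ, 0 < e ∧ localMultiplicity R = e := by
  obtain ⟨e, he⟩ := exists_eventually_numGenerators_maximalIdeal_pow_eq hdim
  obtain ⟨k, hk⟩ := he.exists
  refine ⟨e, Nat.pos_of_ne_zero ?_, localMultiplicity_eq hdim he⟩
  rintro rfl
  rw [numGenerators_eq_zero_iff, Submodule.subsingleton_iff_eq_bot] at hk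
  exact maximalIdeal_pow_ne_bot hdim k hk

theorem isSMulRegular_of_span_singleton_mul_pow_eq {S : Type*} [CommRing S] {I : Ideal S} {y z : S}
    {k : ℕ} (hz : IsSMulRegular S z) (hzI : z ∈ I) (h : Ideal.span {y} * I ^ k = I ^ (k + 1)) :
    IsSMulRegular S y := by
  obtain ⟨w, -, hw⟩ := Ideal.mem_span_singleton_mul.mp (h ▸ Ideal.pow_mem_pow hzI (k + 1))
  have hpow : IsSMulRegular S (w * y) := by rw [mul_comm, hw]; exact hz.pow (k + 1)
  exact hpow.of_mul

theorem numGenerators_add_mul_localMultiplicity_le (hdim : ringKrullDim R = 1) {z : R}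
    (hz : IsSMulRegular R z) (hzm : z ∈ maximalIdeal R) {N : Type*} [AddCommGroup N] [Module R N]
    [Module.Finite R N] {r m : ℕ} {f : N × (Fin r → R) →ₗ[R] Fin m → R}
    (hf : Function.Injective f) :
    (numGenerators R N : ℝ) + r * localMultiplicity R ≤ m * localMultiplicity R := by
  obtain ⟨e, he⟩ := exists_eventually_numGenerators_maximalIdeal_pow_eq hdim
  obtain ⟨c, y, hy, hred⟩ := exists_reduction_of_ringKrullDim_eq_one hdim
  obtain ⟨k, hk, hkc⟩ := (he.and (eventually_ge_atTop c)).exists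
  set S := GenericExtension R
  have hzS : IsSMulRegular S (algebraMap R S z) := hz.of_flat
  have hzmS : algebraMap R S z ∈ maximalIdeal S :=
    GenericExtension.map_maximalIdeal R ▸ Ideal.mem_map_of_mem _ hzm
  let eS (n : ℕ) : S ⊗[R] (Fin n → R) ≃ₗ[S] (Fin n → S) := TensorProduct.piScalarRight R S S (Fin n)
  let eN : ((S ⊗[R] N) × (Fin r → S)) ≃ₗ[S] S ⊗[R] (N × (Fin r → R)) :=
    (LinearEquiv.refl S _).prodCongr (eS r).symm ≪≫ₗ (TensorProduct.prodRight R S S N _).symm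
  let fS : (S ⊗[R] N) × (Fin r → S) →ₗ[S] Fin m → S :=
    (eS m).toLinearMap ∘ₗ f.baseChange S ∘ₗ eN.toLinearMap
  have hinj : Function.Injective fS :=
    (eS m).injective.comp
      ((Module.Flat.lTensor_preserves_injective_linearMap f hf).comp eN.injective)
  have hle := numGenerators_add_le_of_reduction (R := S) (N := S ⊗[R] N) (r := r) (f := fS)
    (isSMulRegular_of_span_singleton_mul_pow_eq hzS hzmS (hred k hkc)) hy (hred k hkc) hinj
  rw [numGenerators_baseChange, GenericExtension.numGenerators_maximalIdeal_pow, hk] at hle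
  rw [localMultiplicity_eq hdim he]
  exact_mod_cast hle

end Multiplicity

section Rank

variable {R : Type*} [CommRing R]

theorem exists_linearMap_comp_eq_smul_id_of_equiv {S : Submonoid R} {M N M' N' : Type*}
    [AddCommGroup M] [Module R M] [AddCommGroup N] [Module R N] [AddCommGroup M'] [Module R M']
    [AddCommGroup N'] [Module R N'] [Module.FinitePresentation R M] [Module.FinitePresentation R N]
    (f : M →ₗ[R] M') (g : N →ₗ[R] N') [IsLocalizedModule S f] [IsLocalizedModule S g]
    (e : M' ≃ₗ[R] N') :
    ∃ s ∈ S, ∃ (φ : M →ₗ[R] N) (ψ : N →ₗ[R] M),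
      φ ∘ₗ ψ = s • LinearMap.id ∧ ψ ∘ₗ φ = s • LinearMap.id := by
  obtain ⟨φ, a, hφ⟩ :=
    Module.FinitePresentation.exists_lift_of_isLocalizedModule S g (e.toLinearMap ∘ₗ f)
  obtain ⟨ψ, b, hψ⟩ :=
    Module.FinitePresentation.exists_lift_of_isLocalizedModule S f (e.symm.toLinearMap ∘ₗ g)
  have hφ' (x : M) : g (φ x) = (a : R) • e (f x) := LinearMap.congr_fun hφ x
  have hψ' (y : N) : f (ψ y) = (b : R) • e.symm (g y) := LinearMap.congr_fun hψ y
  obtain ⟨c, hc⟩ := Module.Finite.exists_smul_of_comp_eq_of_isLocalizedModule S g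
    (φ ∘ₗ ψ) ((a * b : R) • LinearMap.id) (LinearMap.ext fun y => by
      simp [hφ', hψ', mul_smul])
  obtain ⟨d, hd⟩ := Module.Finite.exists_smul_of_comp_eq_of_isLocalizedModule S f
    (ψ ∘ₗ φ) ((a * b : R) • LinearMap.id) (LinearMap.ext fun x => by
      simp [hφ', hψ', mul_smul, smul_comm (a : R)])
  have hc' : (c : R) • φ ∘ₗ ψ = (c : R) • (a * b : R) • LinearMap.id := hc
  have hd' : (d : R) • ψ ∘ₗ φ = (d : R) • (a * b : R) • LinearMap.id := hd
  refine ⟨d * c * (a * b), mul_mem (mul_mem d.2 c.2) (mul_mem a.2 b.2), (d * c : R) • φ, ψ, ?_, ?_⟩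
  · rw [LinearMap.smul_comp, mul_smul, hc', ← mul_smul, ← mul_smul, mul_assoc]
  · rw [LinearMap.comp_smul, mul_comm (d : R), mul_smul, hd', ← mul_smul, ← mul_smul, mul_assoc]

variable {M : Type*} [AddCommGroup M] [Module R M]

theorem free_and_finrank_tensorProduct_of_isUnit {p : Ideal R} [p.IsPrime] {r : ℕ}
    (hfree : Module.Free (Localization.AtPrime p) (LocalizedModule p.primeCompl M))
    (hrank : Module.finrank (Localization.AtPrime p) (LocalizedModule p.primeCompl M) = r)
    (K : Type*) [CommRing K] [Nontrivial K] [Algebra R K]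
    (hK : ∀ a ∉ p, IsUnit (algebraMap R K a)) :
    Module.Free K (K ⊗[R] M) ∧ Module.finrank K (K ⊗[R] M) = r := by
  let L := Localization.AtPrime p
  let f : L →+* K := IsLocalization.lift (M := p.primeCompl) (g := algebraMap R K)
    fun y => hK y y.2
  let := f.toAlgebra
  have : IsScalarTower R L K := IsScalarTower.of_algebraMap_eq fun a =>
    (IsLocalization.lift_eq _ a).symm
  have eL : LocalizedModule p.primeCompl M ≃ₗ[L] L ⊗[R] M :=
    LocalizedModule.equivTensorProduct p.primeCompl M
  have hfreeL : Module.Free L (L ⊗[R] M) := Module.Free.of_equiv eL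
  have eK : K ⊗[L] (L ⊗[R] M) ≃ₗ[K] K ⊗[R] M :=
    TensorProduct.AlgebraTensorModule.cancelBaseChange R L K K M
  refine ⟨Module.Free.of_equiv eK, ?_⟩
  rw [← eK.finrank_eq, Module.finrank_baseChange, ← eL.finrank_eq, hrank]

variable [IsNoetherianRing R]

theorem exists_mem_associatedPrimes_of_ne_top {P : Ideal (FractionRing R)} (hP : P ≠ ⊤) :
    ∃ p ∈ associatedPrimes R R, P.comap (algebraMap R (FractionRing R)) ≤ p := by
  refine ((P.comap (algebraMap R (FractionRing R))).subset_union_prime_finite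
    (associatedPrimes.finite R R) (f := id) 0 0 fun _ h _ _ => h.isPrime).mp ?_
  simp_rw [id, biUnion_associatedPrimes_eq_compl_nonZeroDivisors]
  exact fun x hx hreg => hP (P.eq_top_of_isUnit_mem hx
    (IsLocalization.map_units (FractionRing R) (⟨x, hreg⟩ : nonZeroDivisors R)))

namespace ModuleHasRank

variable {r : ℕ}

theorem free_and_finrank_tensorProduct (hr : ModuleHasRank R M r) {P : Ideal (FractionRing R)}
    (hP : P ≠ ⊤) (K : Type*) [CommRing K] [Nontrivial K] [Algebra (FractionRing R) K]
    (hK : ∀ a ∉ P, IsUnit (algebraMap (FractionRing R) K a)) :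
    Module.Free K (K ⊗[FractionRing R] (FractionRing R ⊗[R] M)) ∧
      Module.finrank K (K ⊗[FractionRing R] (FractionRing R ⊗[R] M)) = r := by
  obtain ⟨p, hp, hle⟩ := exists_mem_associatedPrimes_of_ne_top hP
  have := hp.isPrime
  obtain ⟨hfree, hrank⟩ := hr p hp
  let : Algebra R K := ((algebraMap (FractionRing R) K).comp (algebraMap R _)).toAlgebra
  have : IsScalarTower R (FractionRing R) K := IsScalarTower.of_algebraMap_eq fun _ => rfl
  obtain ⟨hfreeK, hrankK⟩ := free_and_finrank_tensorProduct_of_isUnit hfree hrank K fun a ha =>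
    hK _ fun h => ha (hle h)
  have e : K ⊗[FractionRing R] (FractionRing R ⊗[R] M) ≃ₗ[K] K ⊗[R] M :=
    TensorProduct.AlgebraTensorModule.cancelBaseChange R (FractionRing R) K K M
  exact ⟨Module.Free.of_equiv e.symm, e.finrank_eq.trans hrankK⟩

theorem flat_fractionRing (hr : ModuleHasRank R M r) :
    Module.Flat (FractionRing R) (FractionRing R ⊗[R] M) := by
  set Q := FractionRing R
  refine Module.flat_of_isLocalized_maximal (R := Q) Q (Q ⊗[R] M)
    (fun P _ => Localization.AtPrime P ⊗[Q] (Q ⊗[R] M))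
    (fun P _ => TensorProduct.mk Q (Localization.AtPrime P) (Q ⊗[R] M) 1) fun P hP => ?_
  have := (hr.free_and_finrank_tensorProduct hP.ne_top (Localization.AtPrime P) fun a ha =>
    IsLocalization.map_units _ (⟨a, ha⟩ : P.primeCompl)).1
  exact Module.Flat.trans Q (Localization.AtPrime P) _

variable [Module.Finite R M]

theorem nonempty_basis (hr : ModuleHasRank R M r) :
    Nonempty (Module.Basis (Fin r) (FractionRing R) (FractionRing R ⊗[R] M)) := by
  have : IsNoetherianRing (FractionRing R) :=
    IsLocalization.isNoetherianRing (nonZeroDivisors R) _ inferInstance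
  have := hr.flat_fractionRing
  refine Module.nonempty_basis_of_flat_of_finrank_eq _ _ r fun P => ?_
  have := P.isMaximal
  let := Ideal.Quotient.field P.asIdeal
  refine (hr.free_and_finrank_tensorProduct P.isMaximal.ne_top _ fun a ha => ?_).2
  exact isUnit_iff_ne_zero.mpr fun h => ha (Ideal.Quotient.eq_zero_iff_mem.mp h)

theorem exists_linearMap_comp_eq_smul_id (hr : ModuleHasRank R M r) :
    ∃ z ∈ nonZeroDivisors R, ∃ (φ : (Fin r → R) →ₗ[R] M) (ψ : M →ₗ[R] Fin r → R),
      φ ∘ₗ ψ = z • LinearMap.id ∧ ψ ∘ₗ φ = z • LinearMap.id := by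
  obtain ⟨b⟩ := hr.nonempty_basis
  set Q := FractionRing R
  have := Module.finitePresentation_of_finite R M
  have hloc (P : Type _) [AddCommGroup P] [Module R P] :
      IsLocalizedModule (nonZeroDivisors R) (TensorProduct.mk R Q P 1) :=
    (isLocalizedModule_iff_isBaseChange _ Q _).mpr (TensorProduct.isBaseChange R P Q)
  exact exists_linearMap_comp_eq_smul_id_of_equiv (TensorProduct.mk R Q (Fin r → R) 1)
    (TensorProduct.mk R Q M 1)
    ((((Pi.basisFun R (Fin r)).baseChange Q).equiv b (Equiv.refl _)).restrictScalars R)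

end ModuleHasRank

end Rank

section TraceBounds

open IsLocalRing

variable {R : Type*} [CommRing R] {M : Type*} [AddCommGroup M] [Module R M]

theorem apply_mem_of_moduleTrace_le {J : Ideal R} (hJ : moduleTrace R M ≤ J)
    (h : Module.Dual R M) (x : M) : h x ∈ J :=
  hJ ⟨h ⊗ₜ x, contractLeft_apply h x⟩

theorem moduleTrace_eq_top_of_equiv {r : ℕ} (E : M ≃ₗ[R] (Fin r → R)) (i : Fin r) :
    moduleTrace R M = ⊤ := by
  rw [Ideal.eq_top_iff_one]
  exact ⟨(LinearMap.proj i ∘ₗ E.toLinearMap) ⊗ₜ E.symm (Pi.single i 1), by simp⟩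

theorem injective_compRight_subtype (N : Type*) [AddCommGroup N] [Module R N] (J : Ideal R) :
    Function.Injective (J.subtype.compRight R : (N →ₗ[R] J) →ₗ[R] Module.Dual R N) :=
  fun _ _ h => LinearMap.ext fun x => Subtype.ext (LinearMap.congr_fun h x)

theorem bijective_compRight_subtype_of_moduleTrace_le {J : Ideal R} (hJ : moduleTrace R M ≤ J) :
    Function.Bijective (J.subtype.compRight R : (M →ₗ[R] J) →ₗ[R] Module.Dual R M) :=
  ⟨injective_compRight_subtype M J, fun h =>
    ⟨h.codRestrict J (apply_mem_of_moduleTrace_le hJ h), LinearMap.ext fun _ => rfl⟩⟩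

theorem subsingleton_of_subsingleton_dual {n : ℕ} {f : M →ₗ[R] Fin n → R}
    (hf : Function.Injective f) [Subsingleton (Module.Dual R M)] : Subsingleton M :=
  ⟨fun x y => hf <| funext fun i => by
    have h0 : LinearMap.proj i ∘ₗ f = 0 := Subsingleton.elim _ _
    exact (LinearMap.congr_fun h0 x).trans (LinearMap.congr_fun h0 y).symm⟩

section LocalRing

variable [IsLocalRing R]

theorem numGenerators_of_equiv {r : ℕ} (E : M ≃ₗ[R] (Fin r → R)) :
    numGenerators R M = r := by
  rw [← numGenerators_congr E.symm, numGenerators_pi, numGenerators_self, mul_one]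

theorem numGenerators_dual_of_equiv {r : ℕ} (E : M ≃ₗ[R] (Fin r → R)) :
    numGenerators R (Module.Dual R M) = r :=
  numGenerators_of_equiv (E.symm.dualMap ≪≫ₗ (Module.piEquiv (Fin r) R R).symm)

theorem numGenerators_pos (R M : Type*) [CommRing R] [IsLocalRing R] [AddCommGroup M] [Module R M]
    [Module.Finite R M] [Nontrivial M] : 0 < numGenerators R M :=
  Nat.pos_of_ne_zero fun h => not_subsingleton M (numGenerators_eq_zero_iff.mp h)

end LocalRing

variable [IsNoetherianRing R]

theorem numGenerators_mul_ideal_le_of_surjective [IsLocalRing R] {J : Ideal R}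
    (hJ : moduleTrace R M ≤ J) {n : ℕ} {π : (Fin n → R) →ₗ[R] M} (hπ : Function.Surjective π) :
    n * numGenerators R J ≤ numGenerators R (Module.Dual R M) +
      numGenerators R (LinearMap.range (LinearMap.lcomp R J (LinearMap.ker π).subtype)) := by
  have := Module.Finite.of_surjective π hπ
  have hexact := LinearMap.exact_lcomp_of_exact_of_surjective J π.exact_subtype_ker_map hπ
  have hexact' : Function.Exact (LinearMap.lcomp R J π)
      (LinearMap.lcomp R J (LinearMap.ker π).subtype).rangeRestrict := fun g => by
    rw [Subtype.ext_iff]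
    exact hexact g
  rw [← numGenerators_pi, numGenerators_congr (Module.piEquiv (Fin n) R J),
    ← numGenerators_congr (LinearEquiv.ofBijective _
      (bijective_compRight_subtype_of_moduleTrace_le hJ))]
  exact numGenerators_le_add_of_exact hexact' (LinearMap.surjective_rangeRestrict _)

theorem one_le_localMultiplicity [IsLocalRing R] (hdim : ringKrullDim R = 1) :
    1 ≤ localMultiplicity R := by
  obtain ⟨e, he, heq⟩ := exists_localMultiplicity_eq hdim
  rw [heq]
  exact_mod_cast he

namespace ModuleHasRank

variable [Module.Finite R M] {r : ℕ}

theorem exists_injective_dual_ker_prod (hr : ModuleHasRank R M r) {n : ℕ}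
    {π : (Fin n → R) →ₗ[R] M} (hπ : Function.Surjective π) :
    ∃ f : Module.Dual R (LinearMap.ker π) × (Fin r → R) →ₗ[R] Fin n → R, Function.Injective f := by
  obtain ⟨z, hz, φ, ψ, hφψ, hψφ⟩ := hr.exists_linearMap_comp_eq_smul_id
  have hz (a : R) (h : z * a = 0) : a = 0 := (mem_nonZeroDivisors_iff.mp hz).1 a h
  obtain ⟨θ, hθ⟩ := Module.projective_lifting_property π φ hπ
  have hπθ (u) : π (θ u) = φ u := LinearMap.congr_fun hθ u
  have hψφ (u) : ψ (φ u) = z • u := LinearMap.congr_fun hψφ u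
  have hφψ (x) : φ (ψ x) = z • x := LinearMap.congr_fun hφψ x
  -- Up to multiplication by `z`, the maps `κ` and `ψ ∘ π` split `Rⁿ` into `ker π` and `Rʳ`.
  let κ : (Fin n → R) →ₗ[R] LinearMap.ker π :=
    (z • LinearMap.id - θ ∘ₗ ψ ∘ₗ π).codRestrict _ fun v => by simp [hπθ, hφψ]
  have hκθ (u) : κ (θ u) = 0 := Subtype.ext (by simp [κ, hπθ, hψφ])
  have hκ (v : LinearMap.ker π) : κ v = z • v := Subtype.ext (by simp [κ])
  let e (m : ℕ) := Module.piEquiv (Fin m) R R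
  let f := LinearMap.coprod κ.dualMap ((ψ ∘ₗ π).dualMap ∘ₗ (e r).toLinearMap)
  have hf (α β v) : f (α, β) v = α (κ v) + e r β (ψ (π v)) := rfl
  refine ⟨(e n).symm.toLinearMap ∘ₗ f,
    (e n).symm.injective.comp ((injective_iff_map_eq_zero f).mpr ?_)⟩
  rintro ⟨α, β⟩ h
  obtain rfl : β = 0 := (e r).map_eq_zero_iff.mp <| LinearMap.ext fun u => hz _ <| by
    simpa [hκθ, hπθ, hψφ, hf] using LinearMap.congr_fun h (θ u)
  refine Prod.ext (LinearMap.ext fun v => hz _ ?_) rfl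
  simpa [hκ, hf] using LinearMap.congr_fun h v

theorem exists_injective_tensorProduct_dual (hr : ModuleHasRank R M r)
    (htf : Module.IsTorsionFree R (M ⊗[R] Module.Dual R M)) :
    ∃ f : M ⊗[R] Module.Dual R M →ₗ[R] (Fin (r * r) → R), Function.Injective f := by
  obtain ⟨z, hz, φ, ψ, hφψ, -⟩ := hr.exists_linearMap_comp_eq_smul_id
  have hz : IsRegular z := isRegular_iff_mem_nonZeroDivisors.mpr hz
  have hcomp : TensorProduct.map φ ψ.dualMap ∘ₗ TensorProduct.map ψ φ.dualMap =
      (z * z) • LinearMap.id := by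
    have hdual : ψ.dualMap ∘ₗ φ.dualMap = z • LinearMap.id := by
      rw [LinearMap.dualMap_comp_dualMap, hφψ]
      exact LinearMap.ext fun h => LinearMap.ext fun x => h.map_smul z x
    rw [← TensorProduct.map_comp, hφψ, hdual, TensorProduct.map_smul_left,
      TensorProduct.map_smul_right, TensorProduct.map_id, mul_smul]
  have hinj : Function.Injective (TensorProduct.map ψ φ.dualMap) := by
    refine .of_comp (f := TensorProduct.map φ ψ.dualMap) ?_
    rw [← LinearMap.coe_comp, hcomp]
    exact (hz.mul hz).isSMulRegular
  let b := Pi.basisFun R (Fin r)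
  let e := ((b.tensorProduct b.dualBasis).reindex finProdFinEquiv).equivFun
  exact ⟨e.toLinearMap ∘ₗ TensorProduct.map ψ φ.dualMap, e.injective.comp hinj⟩

variable [IsLocalRing R]

theorem nonempty_equiv_or_exists_isSMulRegular (hr : ModuleHasRank R M r) :
    Nonempty (M ≃ₗ[R] (Fin r → R)) ∨ ∃ z ∈ maximalIdeal R, IsSMulRegular R z := by
  obtain ⟨z, hz, φ, ψ, hφψ, hψφ⟩ := hr.exists_linearMap_comp_eq_smul_id
  by_cases hu : IsUnit z
  · obtain ⟨u, rfl⟩ := hu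
    refine .inl ⟨.ofLinearMap ψ (u⁻¹ • φ) ?_ ?_⟩
    · rw [LinearMap.comp_smul, hψφ]
      exact inv_smul_smul u _
    · rw [LinearMap.smul_comp, hφψ]
      exact inv_smul_smul u _
  · exact .inr ⟨z, hu, (isRegular_iff_mem_nonZeroDivisors.mpr hz).isSMulRegular⟩

theorem numGenerators_mul_ideal_add_le (hdim : ringKrullDim R = 1) (hr : ModuleHasRank R M r)
    {J : Ideal R} (hJ : moduleTrace R M ≤ J) :
    (numGenerators R M * numGenerators R J : ℝ) + r * localMultiplicity R ≤
      numGenerators R (Module.Dual R M) + numGenerators R M * localMultiplicity R := by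
  rcases hr.nonempty_equiv_or_exists_isSMulRegular with ⟨⟨E⟩⟩ | ⟨z, hzm, hz⟩
  · have hle : r * numGenerators R J ≤ r := by
      rcases r.eq_zero_or_pos with rfl | hr0
      · simp
      · obtain rfl : J = ⊤ := top_le_iff.mp (moduleTrace_eq_top_of_equiv E ⟨0, hr0⟩ ▸ hJ)
        rw [numGenerators_congr Submodule.topEquiv, numGenerators_self, mul_one]
    rw [numGenerators_of_equiv E, numGenerators_dual_of_equiv E]
    gcongr
    exact_mod_cast hle
  · obtain ⟨π, hπ⟩ := exists_surjective_of_numGenerators (R := R) (P := M)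
    obtain ⟨f, hf⟩ := hr.exists_injective_dual_ker_prod hπ
    let res := LinearMap.lcomp R J (LinearMap.ker π).subtype
    let ι := J.subtype.compRight R ∘ₗ (LinearMap.range res).subtype
    have hι : Function.Injective (ι.prodMap (LinearMap.id : (Fin r → R) →ₗ[R] _)) :=
      ((injective_compRight_subtype _ J).comp (Submodule.subtype_injective _)).prodMap
        Function.injective_id
    have hrange := numGenerators_add_mul_localMultiplicity_le hdim hz hzm
      (N := LinearMap.range res) (r := r) (f := f ∘ₗ ι.prodMap LinearMap.id) (hf.comp hι)
    have hsum : (numGenerators R M * numGenerators R J : ℝ) ≤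
        numGenerators R (Module.Dual R M) + numGenerators R (LinearMap.range res) := by
      exact_mod_cast numGenerators_mul_ideal_le_of_surjective hJ hπ
    linarith

theorem numGenerators_tensorProduct_dual_le (hdim : ringKrullDim R = 1) (hr : ModuleHasRank R M r)
    (htf : Module.IsTorsionFree R (M ⊗[R] Module.Dual R M)) :
    (numGenerators R (M ⊗[R] Module.Dual R M) : ℝ) ≤ r ^ 2 * localMultiplicity R := by
  rcases hr.nonempty_equiv_or_exists_isSMulRegular with ⟨⟨E⟩⟩ | ⟨z, hzm, hz⟩
  · rw [numGenerators_tensorProduct, numGenerators_of_equiv E, numGenerators_dual_of_equiv E,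
      Nat.cast_mul, ← sq]
    exact le_mul_of_one_le_right (by positivity) (one_le_localMultiplicity hdim)
  · obtain ⟨f, hf⟩ := hr.exists_injective_tensorProduct_dual htf
    have hle := numGenerators_add_mul_localMultiplicity_le hdim hz hzm (r := 0)
      (f := f ∘ₗ LinearMap.fst R _ _) (hf.comp fun _ _ h => Prod.ext h (Subsingleton.elim _ _))
    simpa [sq] using hle

theorem numGenerators_ideal_le [Nontrivial M] (hdim : ringKrullDim R = 1)
    (hr : ModuleHasRank R M r) {J : Ideal R} (hJ : moduleTrace R M ≤ J) :
    (numGenerators R J : ℝ) ≤ localMultiplicity R * (1 - r / numGenerators R M) +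
      numGenerators R (M ⊗[R] Module.Dual R M) / numGenerators R M ^ 2 := by
  have hn := numGenerators_pos R M
  have h := hr.numGenerators_mul_ideal_add_le hdim hJ
  rw [numGenerators_tensorProduct, Nat.cast_mul]
  have hsplit : localMultiplicity R * (1 - r / numGenerators R M) +
      numGenerators R M * numGenerators R (Module.Dual R M) / numGenerators R M ^ 2 =
      (numGenerators R (Module.Dual R M) + numGenerators R M * localMultiplicity R -
        r * localMultiplicity R) / numGenerators R M := by
    field_simp
    ring
  rw [hsplit, le_div_iff₀ (by positivity)]
  linarith

theorem lt_numGenerators_of_not_free (hdim : ringKrullDim R = 1) (hr : ModuleHasRank R M r)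
    (hfree : ¬ Module.Free R M) : r < numGenerators R M := by
  by_contra! hle
  rcases hr.nonempty_equiv_or_exists_isSMulRegular with ⟨⟨E⟩⟩ | ⟨z, hzm, hz⟩
  · exact hfree (.of_equiv E.symm)
  · obtain ⟨π, hπ⟩ := exists_surjective_of_numGenerators (R := R) (P := M)
    obtain ⟨f, hf⟩ := hr.exists_injective_dual_ker_prod hπ
    have hbound := numGenerators_add_mul_localMultiplicity_le hdim hz hzm hf
    have hmul : (numGenerators R M : ℝ) * localMultiplicity R ≤ r * localMultiplicity R := by
      have := one_le_localMultiplicity hdim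
      gcongr
    have hzero : (numGenerators R (Module.Dual R (LinearMap.ker π)) : ℝ) ≤ 0 := by linarith
    have := numGenerators_eq_zero_iff.mp (Nat.le_zero.mp (by exact_mod_cast hzero))
    have hker : Subsingleton (LinearMap.ker π) :=
      subsingleton_of_subsingleton_dual (LinearMap.ker π).subtype_injective
    have hinj : Function.Injective π :=
      LinearMap.ker_eq_bot.mp ((Submodule.subsingleton_iff_eq_bot).mp hker)
    exact hfree (.of_equiv (LinearEquiv.ofBijective π ⟨hinj, hπ⟩))

end ModuleHasRank

end TraceBounds

theorem proposition3p3 {R : Type*} [CommRing R] [IsLocalRing R] [IsNoetherianRing R]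
    (hdim : ringKrullDim R = 1)
    {M : Type*} [AddCommGroup M] [Module R M] [Module.Finite R M] [Nontrivial M]
    (r : ℕ) (hr : ModuleHasRank R M r)
    (htf : Module.IsTorsionFree R (M ⊗[R] Module.Dual R M))
    (ρ : ℝ) (hρ : ρ = (r : ℝ) / (numGenerators R M : ℝ))
    (J : Ideal R) (hJ : moduleTrace R M ≤ J) :
    (numGenerators R J : ℝ) ≤
        localMultiplicity R * (1 - ρ) +
          (numGenerators R (M ⊗[R] Module.Dual R M) : ℝ) / (numGenerators R M : ℝ) ^ 2 ∧
      localMultiplicity R * (1 - ρ) +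
          (numGenerators R (M ⊗[R] Module.Dual R M) : ℝ) / (numGenerators R M : ℝ) ^ 2 ≤
        localMultiplicity R * (1 - ρ + ρ ^ 2) ∧
      (0 < r → ¬ Module.Free R M → (numGenerators R J : ℝ) ≤ localMultiplicity R - 1) := by
  have hn := numGenerators_pos R M
  have hfirst := hr.numGenerators_ideal_le hdim hJ
  have htensor : (numGenerators R (M ⊗[R] Module.Dual R M) : ℝ) / numGenerators R M ^ 2 ≤
      localMultiplicity R * ρ ^ 2 := by
    rw [hρ, div_pow, mul_div_assoc', mul_comm (localMultiplicity R)]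
    gcongr
    exact hr.numGenerators_tensorProduct_dual_le hdim htf
  rw [← hρ] at hfirst
  have hsecond : localMultiplicity R * (1 - ρ) +
      (numGenerators R (M ⊗[R] Module.Dual R M) : ℝ) / numGenerators R M ^ 2 ≤
        localMultiplicity R * (1 - ρ + ρ ^ 2) := by
    linarith
  refine ⟨hfirst, hsecond, fun hr0 hfree => ?_⟩
  have hρ0 : 0 < ρ := by rw [hρ]; positivity
  have hρ1 : ρ < 1 := by
    rw [hρ, div_lt_one (by positivity)]
    exact_mod_cast hr.lt_numGenerators_of_not_free hdim hfree
  obtain ⟨e, he, heq⟩ := exists_localMultiplicity_eq hdim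
  rw [heq] at hfirst hsecond ⊢
  have hlt : (numGenerators R J : ℝ) < e := (hfirst.trans hsecond).trans_lt
    (mul_lt_of_lt_one_right (Nat.cast_pos.mpr he) (by nlinarith))
  exact le_sub_iff_add_le.mpr (by exact_mod_cast hlt)
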